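/- For $n\ge 1$ and a symmetric matrix $(p_{ij})_{i,j=1}^n$ with entries in $[0,1]$, let $A$ be the adjacency matrix of the inhomogeneous Erdős–Rényi random graph $G(n,(p_{ij}))$: $A$ is a random symmetric $n\times n$ matrix with entries in $\{0,1\}$, the entries $A_{ij}$, $i\le j$, are independent, and $\mathbb P(A_{ij}=1)=p_{ij}$ (self-loops are allowed; graphs without self-loops correspond to $p_{ii}=0$). Let $\mathbb E A=(\mathbb E A_{ij})$, let $\|\cdot\|$ be the operator norm with respect to the Euclidean norm on $\mathbb R^n$, and let $d=\max_i\sum_j p_{ij}$ be the maximal expected degree. Then there is an absolute constant $C>0$ such that, for all $n$, $(p_{ij})$ and $A$ as above, $$\mathbb E\|A-\mathbb E A\|\le C\left(\sqrt d+\sqrt{\log n}\right).$$ In particular, for every $c>0$ there is a constant $C_c>0$ depending only on $c$ such that, for all $n$, $(p_{ij})$ and $A$ as above with $d\ge c\log n$, $$\mathbb E\|A-\mathbb E A\|\le C_c\sqrt d.$$ -/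

import Mathlib

universe u

open MeasureTheory ProbabilityTheory
open scoped Matrix.Norms.L2Operator

/-- `A` is (a version of) the adjacency matrix of an inhomogeneous Erdős–Rényi random graph
`G(n, (p i j))` on the vertex set `Fin n`: a random symmetric 0/1-matrix whose entries on and
above the diagonal are independent, with `ℙ(A i j = 1) = p i j`. Self-loops are allowed; a graph
without self-loops is the case `p i i = 0`. The condition `prob` forces `p` to be symmetric with
entries in `[0, 1]`. -/
structure IsInhomogeneousRandomGraph {n : ℕ} {Ω : Type*} [MeasurableSpace Ω] (μ : Measure Ω)
    (p : Matrix (Fin n) (Fin n) ℝ) (A : Ω → Matrix (Fin n) (Fin n) ℝ) : Prop where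
  measurable : ∀ i j, Measurable fun ω => A ω i j
  symm : ∀ ω, (A ω).IsSymm
  zero_or_one : ∀ ω i j, A ω i j = 0 ∨ A ω i j = 1
  prob : ∀ i j, μ.real {ω | A ω i j = 1} = p i j
  indep : iIndepFun (fun (e : {e : Fin n × Fin n // e.1 ≤ e.2}) (ω : Ω) => A ω e.1.1 e.1.2) μ

/-- The entrywise expectation of a random matrix. -/
noncomputable def expectedMatrix {n : ℕ} {Ω : Type*} [MeasurableSpace Ω] (μ : Measure Ω)
    (A : Ω → Matrix (Fin n) (Fin n) ℝ) : Matrix (Fin n) (Fin n) ℝ :=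
  Matrix.of fun i j => ∫ ω, A ω i j ∂μ

/-- The maximal expected degree `d = max_i ∑_j p i j`. -/
noncomputable def maxExpectedDegree {n : ℕ} (p : Matrix (Fin n) (Fin n) ℝ) : ℝ :=
  ⨆ i, ∑ j, p i j

/-!
The moment method with a dimension-free comparison. For even `q` the operator norm of a symmetric
matrix satisfies `‖X‖ ^ q ≤ tr (X ^ q)`, and the trace expands over closed walks of length `q`. Let
`X = A - 𝔼 A`. By independence and centring only walks traversing none of their edges exactly once
contribute, and each contributes at most the product of the variances of its distinct edges. Summing
over the walks with a given coincidence pattern, every new vertex costs a factor at most `d`.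

The same patterns are counted by a dense symmetric matrix `Y` of dimension `N = 2q` whose entries
are independent and centred with all moments of order at least `2` bounded below by `1`: if `d ≤ q`,
every new vertex can be chosen in at least `N - q ≥ d` ways. Hence
`𝔼 tr (X ^ q) ≤ (n / N) 𝔼 tr (Y ^ q) ≤ n 𝔼 (‖Y‖ ^ q)`. A union bound over a `1/2`-net gives
`𝔼 (‖Y‖ ^ q) ≤ (C √q) ^ q`, and with `q` of order `d + log n` the factor `n ^ (1 / q)` is bounded.
-/

section WalkSums

variable {R α : Type*} [Fintype α]

theorem sum_pi_fin_succ_eq_sum_snoc [AddCommMonoid R] {k : ℕ} (f : (Fin (k + 1) → α) → R) :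
    ∑ w, f w = ∑ u : Fin k → α, ∑ x, f (Fin.snoc u x) := by
  rw [← (Fin.snocEquiv fun _ : Fin (k + 1) => α).sum_comp, Fintype.sum_prod_type_right]
  rfl

variable [CommSemiring R] [DecidableEq α]

theorem sum_pow_apply_mul_eq_sum_walk (M : Matrix α α R) (k : ℕ) (H : α → α → R) :
    ∑ a, ∑ b, (M ^ k) a b * H a b = ∑ w : Fin (k + 1) → α,
      (∏ i : Fin k, M (w i.castSucc) (w i.succ)) * H (w 0) (w (Fin.last k)) := by
  induction k generalizing H with
  | zero =>
    rw [← (Equiv.funUnique (Fin 1) α).symm.sum_comp]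
    simp [Matrix.one_apply]
  | succ k ih =>
    have split_last_step : ∑ a, ∑ b, (M ^ (k + 1)) a b * H a b =
        ∑ a, ∑ c, (M ^ k) a c * ∑ b, M c b * H a b := by
      refine Finset.sum_congr rfl fun a _ => ?_
      simp only [pow_succ, Matrix.mul_apply, Finset.sum_mul, Finset.mul_sum, mul_assoc]
      exact Finset.sum_comm
    rw [split_last_step, ih fun a c => ∑ b, M c b * H a b,
      sum_pi_fin_succ_eq_sum_snoc (k := k + 1)]
    refine Finset.sum_congr rfl fun u _ => ?_
    rw [Finset.mul_sum]
    refine Finset.sum_congr rfl fun x _ => ?_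
    rw [Fin.prod_univ_castSucc, Fin.succ_last]
    simp only [Fin.succ_castSucc, Fin.snoc_castSucc, Fin.snoc_last, Fin.snoc_apply_zero, mul_assoc]

theorem trace_pow_succ_eq_sum_closedWalk (M : Matrix α α R) (k : ℕ) :
    (M ^ (k + 1)).trace = ∑ w : Fin (k + 1) → α, ∏ i, M (w i) (w (i + 1)) := by
  calc (M ^ (k + 1)).trace = ∑ a, ∑ b, (M ^ k) a b * M b a := by
        simp only [pow_succ, Matrix.trace, Matrix.diag, Matrix.mul_apply]
    _ = _ := by
        rw [sum_pow_apply_mul_eq_sum_walk M k fun a b => M b a]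
        simp only [Fin.prod_univ_castSucc, Fin.coeSucc_eq_succ, Fin.last_add_one]

end WalkSums

theorem norm_pow_of_isSelfAdjoint {A : Type*} [NormedRing A] [StarRing A] [CStarRing A] {x : A}
    (hx : IsSelfAdjoint x) {m : ℕ} (hm : m ≠ 0) : ‖x ^ m‖ = ‖x‖ ^ m := by
  refine le_antisymm (norm_pow_le' x (Nat.pos_of_ne_zero hm)) ?_
  rcases (norm_nonneg x).eq_or_lt with norm_zero | norm_pos
  · rw [← norm_zero, zero_pow hm]
    exact norm_nonneg _
  have lt_two_pow : m < 2 ^ m := Nat.lt_two_pow_self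
  have mul_le : ‖x‖ ^ m * ‖x‖ ^ (2 ^ m - m) ≤ ‖x ^ m‖ * ‖x‖ ^ (2 ^ m - m) := by
    calc ‖x‖ ^ m * ‖x‖ ^ (2 ^ m - m) = ‖x ^ m * x ^ (2 ^ m - m)‖ := by
          rw [← pow_add, ← pow_add, Nat.add_sub_cancel' lt_two_pow.le, hx.norm_pow_two_pow]
      _ ≤ ‖x ^ m‖ * ‖x ^ (2 ^ m - m)‖ := norm_mul_le _ _
      _ ≤ ‖x ^ m‖ * ‖x‖ ^ (2 ^ m - m) := by
          gcongr
          exact norm_pow_le' x (Nat.sub_pos_of_lt lt_two_pow)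
  exact le_of_mul_le_mul_right mul_le (pow_pos norm_pos _)

section OperatorNorm

variable {m n : Type*} [Fintype m] [Fintype n] [DecidableEq n]

theorem sq_l2_opNorm_le_sum_sq (M : Matrix m n ℝ) :
    ‖M‖ ^ 2 ≤ ∑ i, ∑ j, M i j ^ 2 := by
  have nonneg : 0 ≤ ∑ i, ∑ j, M i j ^ 2 := by positivity
  suffices ‖M‖ ≤ √(∑ i, ∑ j, M i j ^ 2) from (Real.le_sqrt (norm_nonneg _) nonneg).1 this
  rw [Matrix.l2_opNorm_def]
  refine ContinuousLinearMap.opNorm_le_bound _ (Real.sqrt_nonneg _) fun x => ?_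
  rw [EuclideanSpace.norm_eq, EuclideanSpace.norm_eq, ← Real.sqrt_mul nonneg, Finset.sum_mul]
  refine Real.sqrt_le_sqrt (Finset.sum_le_sum fun i _ => ?_)
  simp only [Real.norm_eq_abs, sq_abs]
  exact Finset.sum_mul_sq_le_sq_mul_sq Finset.univ (M i) x.ofLp

theorem norm_pow_two_mul_le_trace_pow {M : Matrix n n ℝ} (hM : M.IsSymm) {k : ℕ} (hk : k ≠ 0) :
    ‖M‖ ^ (2 * k) ≤ (M ^ (2 * k)).trace := by
  calc ‖M‖ ^ (2 * k) = ‖M ^ k‖ ^ 2 := by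
        have selfAdjoint : IsSelfAdjoint M :=
          (Matrix.conjTranspose_eq_transpose_of_trivial M).trans hM
        rw [norm_pow_of_isSelfAdjoint selfAdjoint hk, ← pow_mul, mul_comm]
    _ ≤ ∑ i, ∑ j, (M ^ k) i j ^ 2 := sq_l2_opNorm_le_sum_sq _
    _ = (M ^ k * (M ^ k).transpose).trace := by
        simp only [Matrix.trace, Matrix.diag, Matrix.mul_apply, Matrix.transpose_apply, sq]
    _ = (M ^ (2 * k)).trace := by rw [(hM.pow k).eq, ← pow_add, two_mul]

theorem trace_le_card_mul_l2_opNorm (M : Matrix n n ℝ) :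
    M.trace ≤ Fintype.card n * ‖M‖ := by
  have diag_le (i : n) : M i i ≤ ‖M‖ := by
    have column_norm_le := Matrix.l2_opNorm_mulVec M (EuclideanSpace.single i 1)
    have entry_le := PiLp.norm_apply_le
      (WithLp.toLp 2 (M.mulVec (EuclideanSpace.single i (1 : ℝ)).ofLp)) i
    simp only [PiLp.ofLp_single, Matrix.mulVec_single, MulOpposite.op_one, one_smul,
      PiLp.continuousLinearEquiv_symm_apply, PiLp.norm_single, norm_one, mul_one, Matrix.col_apply,
      Real.norm_eq_abs] at column_norm_le entry_le
    exact (le_abs_self _).trans (entry_le.trans column_norm_le)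
  calc M.trace ≤ ∑ _i : n, ‖M‖ := Finset.sum_le_sum fun i _ => diag_le i
    _ = Fintype.card n * ‖M‖ := by rw [Finset.sum_const, nsmul_eq_mul, Finset.card_univ]

end OperatorNorm

open Metric in
theorem coveringNumber_half_closedBall_le (E : Type*) [NormedAddCommGroup E] [NormedSpace ℝ E]
    [FiniteDimensional ℝ E] :
    coveringNumber (1 / 2) (closedBall (0 : E) 1) ≤ 5 ^ Module.finrank ℝ E := by
  classical
  refine (coveringNumber_le_packingNumber _ _).trans (iSup₂_le fun S hS => iSup_le fun hsep => ?_)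
  have card_le (T : Finset E) (hT : ↑T ⊆ S) : T.card ≤ 5 ^ Module.finrank ℝ E := by
    rw [← Finset.card_image_of_injective T (smul_right_injective E (two_ne_zero (α := ℝ)))]
    refine Besicovitch.card_le_of_separated _ (fun c hc => ?_) fun c hc d hd hcd => ?_
    · obtain ⟨x, hx, rfl⟩ := Finset.mem_image.1 hc
      have hx1 : ‖x‖ ≤ 1 := mem_closedBall_zero_iff.1 (hS (hT hx))
      rw [norm_smul, Real.norm_two]
      linarith
    · obtain ⟨x, hx, rfl⟩ := Finset.mem_image.1 hc
      obtain ⟨y, hy, rfl⟩ := Finset.mem_image.1 hd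
      have hxy : ((1 / 2 : NNReal) : ENNReal) < edist x y :=
        hsep (hT hx) (hT hy) (ne_of_apply_ne _ hcd)
      rw [edist_nndist, ENNReal.coe_lt_coe, ← NNReal.coe_lt_coe, coe_nndist, dist_eq_norm] at hxy
      norm_num at hxy
      simp only [← smul_sub, norm_smul, Real.norm_two]
      linarith
  by_contra! hlt
  obtain ⟨T, hTS, hT⟩ := Set.exists_subset_encard_eq (Order.add_one_le_of_lt hlt)
  have hfin : T.Finite := Set.finite_of_encard_eq_coe (k := 5 ^ Module.finrank ℝ E + 1)
    (by rw [hT]; norm_cast)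
  have := card_le hfin.toFinset (by simpa using hTS)
  rw [hfin.encard_eq_coe_toFinset_card] at hT
  norm_cast at hT
  omega

section Nets

variable {E F : Type*} [NormedAddCommGroup E] [NormedAddCommGroup F]

open Metric in
theorem exists_norm_sub_le_half_of_isCover {N : Set E}
    (hN : IsCover (1 / 2) (closedBall (0 : E) 1) N) {z : E} (hz : ‖z‖ ≤ 1) :
    ∃ w ∈ N, ‖z - w‖ ≤ 1 / 2 := by
  simpa [dist_eq_norm] using hN.subset_iUnion_closedBall (mem_closedBall_zero_iff.2 hz)

open Metric in
theorem exists_opNorm_le_two_mul_norm_apply_of_isCover [NormedSpace ℝ E] [NormedSpace ℝ F]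
    {N : Finset E}
    (hN : IsCover (1 / 2) (closedBall (0 : E) 1) N) (L : E →L[ℝ] F) :
    ∃ x ∈ N, ‖L‖ ≤ 2 * ‖L x‖ := by
  have hne : N.Nonempty := by simpa using hN.nonempty ⟨0, by simp⟩
  obtain ⟨x, hx, hmax⟩ := N.exists_max_image (fun x => ‖L x‖) hne
  have hle : ‖L‖ ≤ ‖L x‖ + ‖L‖ * (1 / 2) := by
    refine L.opNorm_le_of_unit_norm (by positivity) fun z hz => ?_
    obtain ⟨w, hw, hzw⟩ := exists_norm_sub_le_half_of_isCover hN hz.le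
    calc ‖L z‖ ≤ ‖L w‖ + ‖L (z - w)‖ := by rw [map_sub]; exact norm_le_insert' _ _
      _ ≤ ‖L x‖ + ‖L‖ * (1 / 2) := add_le_add (hmax w hw) (L.le_opNorm_of_le hzw)
  exact ⟨x, hx, by linarith⟩

open Metric in
theorem exists_norm_le_two_mul_inner_of_isCover [InnerProductSpace ℝ F] {N : Set F}
    (hN : IsCover (1 / 2) (closedBall (0 : F) 1) N) (v : F) :
    ∃ y ∈ N, ‖v‖ ≤ 2 * inner ℝ y v := by
  obtain ⟨y, hy, hyv⟩ := exists_norm_sub_le_half_of_isCover hN (z := ‖v‖⁻¹ • v)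
    (by rw [norm_smul, norm_inv, norm_norm]; exact inv_mul_le_one)
  have hself : inner ℝ (‖v‖⁻¹ • v) v = ‖v‖ := by
    rw [real_inner_smul_left, real_inner_self_eq_norm_sq, pow_two, ← mul_assoc, inv_mul_mul_self]
  have hdiff : inner ℝ (‖v‖⁻¹ • v - y) v ≤ 1 / 2 * ‖v‖ :=
    (real_inner_le_norm _ _).trans (by gcongr)
  rw [inner_sub_left, hself] at hdiff
  exact ⟨y, hy, by linarith⟩

end Nets

open Metric in
theorem exists_finset_l2_opNorm_le_four_mul_inner (n : Type*) [Fintype n] [DecidableEq n] :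
    ∃ N : Finset (EuclideanSpace ℝ n), N.card ≤ 5 ^ Fintype.card n ∧ (∀ x ∈ N, ‖x‖ ≤ 1) ∧
      ∀ M : Matrix n n ℝ, ∃ x ∈ N, ∃ y ∈ N,
        ‖M‖ ≤ 4 * inner ℝ x (Matrix.toEuclideanCLM (𝕜 := ℝ) M y) := by
  set B := closedBall (0 : EuclideanSpace ℝ n) 1
  have hcard : coveringNumber (1 / 2) B ≤ 5 ^ Fintype.card n := by
    simpa using coveringNumber_half_closedBall_le (EuclideanSpace ℝ n)
  have hfinite : coveringNumber (1 / 2) B ≠ ⊤ := ne_top_of_le_ne_top (by norm_cast; simp) hcard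
  have net_finite := finite_minimalCover (ε := 1 / 2) (A := B)
  have hcover : IsCover (1 / 2) B (net_finite.toFinset : Set _) := by
    simpa using isCover_minimalCover hfinite
  refine ⟨net_finite.toFinset, ?_, fun x hx => ?_, fun M => ?_⟩
  · rw [← encard_minimalCover hfinite, net_finite.encard_eq_coe_toFinset_card] at hcard
    exact_mod_cast hcard
  · exact mem_closedBall_zero_iff.1 (minimalCover_subset (net_finite.mem_toFinset.1 hx))
  · obtain ⟨y, hy, hMy⟩ :=
      exists_opNorm_le_two_mul_norm_apply_of_isCover hcover (Matrix.toEuclideanCLM (𝕜 := ℝ) M)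
    obtain ⟨x, hx, hxy⟩ :=
      exists_norm_le_two_mul_inner_of_isCover hcover (Matrix.toEuclideanCLM (𝕜 := ℝ) M y)
    rw [← Matrix.cstar_norm_def] at hMy
    exact ⟨x, hx, y, hy, by linarith⟩

section WalkPatterns

theorem ker_snoc_eq_iff {α : Type*} {n : ℕ} (u : Fin n → α) (x : α)
    (s : Setoid (Fin (n + 1))) :
    Setoid.ker (Fin.snoc u x : Fin (n + 1) → α) = s ↔
      Setoid.ker u = s.comap Fin.castSucc ∧ ∀ i : Fin n, u i = x ↔ s i.castSucc (Fin.last _) := by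
  simp only [Setoid.ext_iff, Setoid.ker_def, Setoid.comap_rel, Fin.forall_fin_succ',
    Fin.snoc_castSucc, Fin.snoc_last, forall_and, s.comm' (x := Fin.last n), eq_comm (a := x)]
  refine ⟨fun h => ⟨h.1.1, h.1.2⟩, fun h => ⟨⟨h.1, h.2⟩, h.2, iff_of_true trivial (s.refl _)⟩⟩

theorem ker_eq_of_subsingleton {α β : Type*} [Subsingleton α] (f : α → β) (s : Setoid α) :
    Setoid.ker f = s := Setoid.ext fun a b => by
  rw [Subsingleton.elim a b]
  exact iff_of_true rfl (s.refl b)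

variable {α R : Type*} [Fintype α] [AddCommMonoid R] {n : ℕ}
  {s : Setoid (Fin (n + 1))}

open scoped Classical in
theorem sum_ker_eq_of_last_mem {l : Fin n} (hl : s l.castSucc (Fin.last _))
    (f : (Fin (n + 1) → α) → R) :
    ∑ w with Setoid.ker w = s, f w =
      ∑ u with Setoid.ker u = s.comap Fin.castSucc, f (Fin.snoc u (u l)) := by
  have pattern_iff (u : Fin n → α) (x : α) : Setoid.ker (Fin.snoc u x : Fin (n + 1) → α) = s ↔
      Setoid.ker u = s.comap Fin.castSucc ∧ u l = x := by
    rw [ker_snoc_eq_iff]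
    refine and_congr_right fun hu => ⟨fun h => (h l).2 hl, ?_⟩
    rintro rfl i
    rw [← Setoid.ker_def, hu, Setoid.comap_rel]
    exact ⟨fun h => s.trans h hl, fun h => s.trans h (s.symm hl)⟩
  simp only [Finset.sum_filter, sum_pi_fin_succ_eq_sum_snoc (k := n), pattern_iff, ite_and]
  refine Finset.sum_congr rfl fun u _ => ?_
  split_ifs <;> simp

open scoped Classical in
theorem sum_ker_eq_of_last_notMem [DecidableEq α]
    (hs : ∀ i : Fin n, ¬ s i.castSucc (Fin.last _))
    (f : (Fin (n + 1) → α) → R) :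
    ∑ w with Setoid.ker w = s, f w =
      ∑ u with Setoid.ker u = s.comap Fin.castSucc, ∑ x with ∀ i, u i ≠ x, f (Fin.snoc u x) := by
  simp only [Finset.sum_filter, sum_pi_fin_succ_eq_sum_snoc (k := n), ker_snoc_eq_iff, hs,
    iff_false, ite_and]
  refine Finset.sum_congr rfl fun u _ => ?_
  split_ifs <;> simp

end WalkPatterns

theorem le_card_forall_ne {W : Type*} [Fintype W] [DecidableEq W] {n : ℕ} {D : ℝ}
    (hW : D + n ≤ Fintype.card W) (v : Fin n → W) : D ≤ ∑ x with ∀ i, v i ≠ x, (1 : ℝ) := by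
  have card_le : Fintype.card W ≤ n + Finset.card {x | ∀ i, v i ≠ x} := by
    have compl_eq : (Finset.univ.image v)ᶜ = Finset.univ.filter fun x => ∀ i, v i ≠ x := by
      ext
      simp
    rw [← Finset.card_add_card_compl (Finset.univ.image v), compl_eq]
    gcongr
    simpa using Finset.card_image_le (s := Finset.univ) (f := v)
  rw [← Finset.cast_card]
  have : (Fintype.card W : ℝ) ≤ n + Finset.card {x | ∀ i, v i ≠ x} := by exact_mod_cast card_le
  linarith

section WalkWeights

variable {V : Type*} [DecidableEq V] {k : ℕ}

/-- The edges `{w 0, w 1}, …, {w (k - 1), w k}` traversed by a walk `w` of length `k`, each listed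
once; the walk is not closed up. -/
def walkEdges (w : Fin (k + 1) → V) : Finset (Sym2 V) :=
  Finset.univ.image fun i : Fin k => s(w i.castSucc, w i.succ)

theorem walkEdges_snoc (u : Fin (k + 1) → V) (x : V) :
    walkEdges (Fin.snoc u x : Fin (k + 2) → V) = insert s(u (Fin.last k), x) (walkEdges u) := by
  ext e
  simp only [walkEdges, Finset.mem_image, Finset.mem_insert, Finset.mem_univ, true_and,
    Fin.exists_fin_succ', Fin.succ_last, Fin.succ_castSucc, Fin.snoc_castSucc, Fin.snoc_last]
  rw [or_comm, eq_comm]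

theorem mem_range_of_mem_walkEdges {w : Fin (k + 1) → V} {a b : V} (h : s(a, b) ∈ walkEdges w) :
    ∃ i, w i = b := by
  obtain ⟨i, -, hi⟩ := Finset.mem_image.1 h
  rcases Sym2.eq_iff.1 hi with ⟨-, h⟩ | ⟨h, -⟩
  exacts [⟨_, h⟩, ⟨_, h⟩]

variable {P : Sym2 V → ℝ}

theorem prod_walkEdges_snoc_le (hP0 : ∀ e, 0 ≤ P e) (hP1 : ∀ e, P e ≤ 1)
    (u : Fin (k + 1) → V) (x : V) :
    ∏ e ∈ walkEdges (Fin.snoc u x : Fin (k + 2) → V), P e ≤ ∏ e ∈ walkEdges u, P e := by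
  rw [walkEdges_snoc]
  by_cases h : s(u (Fin.last k), x) ∈ walkEdges u
  · rw [Finset.insert_eq_of_mem h]
  · rw [Finset.prod_insert h]
    exact mul_le_of_le_one_left (Finset.prod_nonneg fun e _ => hP0 e) (hP1 _)

theorem sum_prod_walkEdges_snoc_le [Fintype V] {D : ℝ} (hP0 : ∀ e, 0 ≤ P e)
    (hD : ∀ a, ∑ b, P s(a, b) ≤ D) (u : Fin (k + 1) → V) :
    ∑ x with ∀ i, u i ≠ x, ∏ e ∈ walkEdges (Fin.snoc u x : Fin (k + 2) → V), P e ≤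
      D * ∏ e ∈ walkEdges u, P e := by
  calc ∑ x with ∀ i, u i ≠ x, ∏ e ∈ walkEdges (Fin.snoc u x : Fin (k + 2) → V), P e
      = ∑ x with ∀ i, u i ≠ x, P s(u (Fin.last k), x) * ∏ e ∈ walkEdges u, P e := by
        refine Finset.sum_congr rfl fun x hx => ?_
        rw [walkEdges_snoc, Finset.prod_insert fun h => ?_]
        obtain ⟨i, hi⟩ := mem_range_of_mem_walkEdges h
        exact (Finset.mem_filter.1 hx).2 i hi
    _ ≤ (∑ x, P s(u (Fin.last k), x)) * ∏ e ∈ walkEdges u, P e := by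
        rw [← Finset.sum_mul]
        refine mul_le_mul_of_nonneg_right ?_ (Finset.prod_nonneg fun e _ => hP0 e)
        exact Finset.sum_le_sum_of_subset_of_nonneg (Finset.subset_univ _) fun _ _ _ => hP0 _
    _ ≤ D * ∏ e ∈ walkEdges u, P e :=
        mul_le_mul_of_nonneg_right (hD _) (Finset.prod_nonneg fun e _ => hP0 e)

variable [Fintype V] {W : Type*} [Fintype W]

open scoped Classical in
theorem card_mul_sum_pattern_le {D : ℝ} (hP0 : ∀ e, 0 ≤ P e) (hD0 : 0 ≤ D)
    (hP1 : ∀ e, P e ≤ 1) (hD : ∀ a, ∑ b, P s(a, b) ≤ D) (hW : D + k ≤ Fintype.card W)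
    (s : Setoid (Fin (k + 1))) :
    Fintype.card W * ∑ w : Fin (k + 1) → V with Setoid.ker w = s, ∏ e ∈ walkEdges w, P e ≤
      Fintype.card V * Finset.card {v : Fin (k + 1) → W | Setoid.ker v = s} := by
  rw [Finset.cast_card]
  induction k with
  | zero =>
    have : Subsingleton (Fin (0 + 1)) := inferInstanceAs (Subsingleton (Fin 1))
    simp [walkEdges, ker_eq_of_subsingleton _ s, mul_comm]
  | succ k ih =>
    have ih := ih (by push_cast at hW; linarith) (s.comap Fin.castSucc)
    by_cases hs : ∃ l : Fin (k + 1), s l.castSucc (Fin.last _)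
    · obtain ⟨l, hl⟩ := hs
      rw [sum_ker_eq_of_last_mem hl, sum_ker_eq_of_last_mem hl]
      refine le_trans ?_ ih
      exact mul_le_mul_of_nonneg_left (Finset.sum_le_sum fun u _ =>
        prod_walkEdges_snoc_le hP0 hP1 u (u l)) (Nat.cast_nonneg _)
    push Not at hs
    rw [sum_ker_eq_of_last_notMem hs, sum_ker_eq_of_last_notMem hs]
    calc Fintype.card W * _
        ≤ Fintype.card W * ∑ u : Fin (k + 1) → V with Setoid.ker u = s.comap Fin.castSucc,
            D * ∏ e ∈ walkEdges u, P e := by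
          gcongr with u
          exact sum_prod_walkEdges_snoc_le hP0 hD u
      _ ≤ D * (Fintype.card V *
            ∑ v : Fin (k + 1) → W with Setoid.ker v = s.comap Fin.castSucc, (1 : ℝ)) := by
          rw [← Finset.mul_sum, mul_left_comm]
          gcongr
      _ ≤ _ := by
          rw [mul_left_comm, Finset.mul_sum]
          gcongr with v
          rw [mul_one]
          exact le_card_forall_ne hW v

open scoped Classical in
theorem card_mul_sum_le_of_patterns {D : ℝ} (hP0 : ∀ e, 0 ≤ P e) (hD0 : 0 ≤ D)
    (hP1 : ∀ e, P e ≤ 1) (hD : ∀ a, ∑ b, P s(a, b) ≤ D) (hW : D + k ≤ Fintype.card W)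
    (Q : Setoid (Fin (k + 1)) → Prop) :
    Fintype.card W * ∑ w : Fin (k + 1) → V with Q (Setoid.ker w), ∏ e ∈ walkEdges w, P e ≤
      Fintype.card V * Finset.card {v : Fin (k + 1) → W | Q (Setoid.ker v)} := by
  have : Finite (Setoid (Fin (k + 1))) :=
    Finite.of_injective (fun s => s.r) fun s t h => Setoid.ext fun a b => by
      exact Iff.of_eq (congrFun₂ h a b)
  cases nonempty_fintype (Setoid (Fin (k + 1)))
  have walks_by_pattern := Finset.sum_fiberwise_eq_sum_filter Finset.univ {s | Q s} Setoid.ker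
    fun w : Fin (k + 1) → V => ∏ e ∈ walkEdges w, P e
  have labels_by_pattern := Finset.sum_fiberwise_eq_sum_filter Finset.univ {s | Q s} Setoid.ker
    fun _ : Fin (k + 1) → W => (1 : ℝ)
  simp only [Finset.mem_filter_univ] at walks_by_pattern labels_by_pattern
  rw [Finset.cast_card, ← walks_by_pattern, ← labels_by_pattern, Finset.mul_sum, Finset.mul_sum]
  simp only [← Finset.cast_card]
  exact Finset.sum_le_sum fun s _ => card_mul_sum_pattern_le hP0 hD0 hP1 hD hW s

end WalkWeights

section ClosedWalks

variable {V : Type*} [DecidableEq V] {k : ℕ}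

/-- The number of times the closed walk `w 0, w 1, …, w k, w 0` traverses the edge `e`. -/
def edgeCount (w : Fin (k + 1) → V) (e : Sym2 V) : ℕ :=
  Finset.card {i | s(w i, w (i + 1)) = e}

/-- For a closed walk `w 0, …, w k, w 0` with coincidence pattern `s = Setoid.ker w`, the property
that no edge is traversed exactly once. It is stated through the pattern alone so that closed walks
on different vertex sets can be compared. -/
def NoSimpleEdge (s : Setoid (Fin (k + 1))) : Prop :=
  ∀ i, ∃ j ≠ i, (s i j ∧ s (i + 1) (j + 1)) ∨ (s i (j + 1) ∧ s (i + 1) j)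

theorem noSimpleEdge_ker_iff (w : Fin (k + 1) → V) :
    NoSimpleEdge (Setoid.ker w) ↔ ∀ e, edgeCount w e ≠ 1 := by
  have same_edge_iff (i j : Fin (k + 1)) : s(w j, w (j + 1)) = s(w i, w (i + 1)) ↔
      (w i = w j ∧ w (i + 1) = w (j + 1)) ∨ (w i = w (j + 1) ∧ w (i + 1) = w j) := by
    rw [eq_comm, Sym2.eq_iff]
  simp only [NoSimpleEdge, Setoid.ker_def, ← same_edge_iff, edgeCount, ne_eq, Finset.card_eq_one,
    not_exists]
  constructor
  · intro h e i hi
    obtain ⟨j, hji, hj⟩ := h i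
    have hie : s(w i, w (i + 1)) = e := by simpa using Finset.ext_iff.1 hi i
    exact hji (by simpa [hj, hie] using Finset.ext_iff.1 hi j)
  · intro h i
    by_contra! unique
    refine h s(w i, w (i + 1)) i (Finset.ext fun j => ?_)
    simp only [Finset.mem_filter_univ, Finset.mem_singleton]
    exact ⟨fun hj => by_contra fun hji => unique j hji hj, fun hj => by rw [hj]⟩

theorem edgeCount_ne_zero_of_mem_walkEdges {w : Fin (k + 1) → V} {e : Sym2 V}
    (he : e ∈ walkEdges w) : edgeCount w e ≠ 0 := by
  obtain ⟨i, -, rfl⟩ := Finset.mem_image.1 he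
  refine Finset.card_ne_zero_of_mem (a := i.castSucc) ?_
  rw [Finset.mem_filter_univ, Fin.coeSucc_eq_succ]

theorem prod_closedWalk_eq_prod_pow_edgeCount [Fintype V] {R : Type*} [CommMonoid R]
    (w : Fin (k + 1) → V) (f : Sym2 V → R) :
    ∏ i, f s(w i, w (i + 1)) = ∏ e, f e ^ edgeCount w e := by
  rw [← Finset.prod_fiberwise' Finset.univ (fun i => s(w i, w (i + 1))) f]
  simp only [Finset.prod_const, edgeCount]

end ClosedWalks

/-- The symmetric matrix with entries `x {i, j}`. -/
def symMatrix {V R : Type*} (x : Sym2 V → R) : Matrix V V R :=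
  Matrix.of fun i j => x s(i, j)

theorem symMatrix_isSymm {V R : Type*} (x : Sym2 V → R) : (symMatrix x).IsSymm :=
  Matrix.ext fun _ _ => congrArg x Sym2.eq_swap

section CenteredFamilies

variable {ι Ω : Type*} [MeasurableSpace Ω]

/-- A family of independent centred random variables bounded by `K`; below, the entries of a random
symmetric matrix. -/
structure IsCenteredBoundedFamily (μ : Measure Ω) (ξ : ι → Ω → ℝ) (K : ℝ) : Prop where
  measurable : ∀ e, Measurable (ξ e)
  indep : iIndepFun ξ μ
  abs_apply_le : ∀ e ω, |ξ e ω| ≤ K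
  integral_eq_zero : ∀ e, ∫ ω, ξ e ω ∂μ = 0

namespace IsCenteredBoundedFamily

variable {μ : Measure Ω} {ξ : ι → Ω → ℝ} {K : ℝ}

theorem integral_prod_pow [Fintype ι] (h : IsCenteredBoundedFamily μ ξ K) (c : ι → ℕ) :
    ∫ ω, ∏ e, ξ e ω ^ c e ∂μ = ∏ e, ∫ ω, ξ e ω ^ c e ∂μ :=
  h.indep.integral_fun_prod_comp (f := fun e x => x ^ c e) (fun e => (h.measurable e).aemeasurable)
    fun e => (continuous_pow (c e)).aestronglyMeasurable

variable [IsProbabilityMeasure μ]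

theorem integrable_pow (h : IsCenteredBoundedFamily μ ξ K) (e : ι) (c : ℕ) :
    Integrable (fun ω => ξ e ω ^ c) μ := by
  refine .of_bound ((h.measurable e).pow_const c).aestronglyMeasurable (K ^ c) (.of_forall ?_)
  intro ω
  rw [norm_pow]
  exact pow_le_pow_left₀ (norm_nonneg _) (h.abs_apply_le e ω) c

theorem abs_integral_pow_le_integral_sq (h : IsCenteredBoundedFamily μ ξ 1) (e : ι) {c : ℕ}
    (hc : 2 ≤ c) : |∫ ω, ξ e ω ^ c ∂μ| ≤ ∫ ω, ξ e ω ^ 2 ∂μ := by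
  refine abs_integral_le_integral_abs.trans
    (integral_mono (h.integrable_pow e c).abs (h.integrable_pow e 2) fun ω => ?_)
  rw [← sq_abs, abs_pow]
  exact pow_le_pow_of_le_one (abs_nonneg _) (h.abs_apply_le e ω) hc

theorem abs_integral_pow_le_one (h : IsCenteredBoundedFamily μ ξ 1) (e : ι) (c : ℕ) :
    |∫ ω, ξ e ω ^ c ∂μ| ≤ 1 := by
  have pow_le (ω : Ω) : ‖ξ e ω ^ c‖ ≤ 1 := by
    rw [norm_pow]
    exact pow_le_one₀ (norm_nonneg _) (h.abs_apply_le e ω)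
  simpa using norm_integral_le_of_norm_le_const (μ := μ) (.of_forall pow_le)

theorem integrable_prod_comp (h : IsCenteredBoundedFamily μ ξ K) {κ : Type*} [Fintype κ]
    (e : κ → ι) : Integrable (fun ω => ∏ i, ξ (e i) ω) μ := by
  refine .of_bound (Finset.measurable_fun_prod _ fun i _ => h.measurable _).aestronglyMeasurable
    (∏ _i : κ, K) (.of_forall fun ω => ?_)
  rw [norm_prod]
  exact Finset.prod_le_prod (fun _ _ => norm_nonneg _) fun _ _ => h.abs_apply_le _ ω

end IsCenteredBoundedFamily

end CenteredFamilies

section TraceMoments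

variable {V Ω : Type*} [MeasurableSpace Ω] {μ : Measure Ω} {ξ : Sym2 V → Ω → ℝ} {K : ℝ}

namespace IsCenteredBoundedFamily

theorem integral_prod_closedWalk [Fintype V] [DecidableEq V] (h : IsCenteredBoundedFamily μ ξ K)
    {k : ℕ} (w : Fin (k + 1) → V) :
    ∫ ω, ∏ i, ξ s(w i, w (i + 1)) ω ∂μ = ∏ e, ∫ ω, ξ e ω ^ edgeCount w e ∂μ := by
  rw [← h.integral_prod_pow (edgeCount w)]
  exact integral_congr_ae (.of_forall fun ω => prod_closedWalk_eq_prod_pow_edgeCount w (ξ · ω))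

theorem integral_prod_closedWalk_eq_zero [Finite V] (h : IsCenteredBoundedFamily μ ξ K) {k : ℕ}
    {w : Fin (k + 1) → V} (hw : ¬ NoSimpleEdge (Setoid.ker w)) :
    ∫ ω, ∏ i, ξ s(w i, w (i + 1)) ω ∂μ = 0 := by
  classical
  cases nonempty_fintype V
  obtain ⟨e, he⟩ : ∃ e, edgeCount w e = 1 := by
    simpa [noSimpleEdge_ker_iff] using hw
  rw [h.integral_prod_closedWalk]
  refine Finset.prod_eq_zero (Finset.mem_univ e) ?_
  simp only [he, pow_one, h.integral_eq_zero]

variable [IsProbabilityMeasure μ]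

theorem integral_prod_closedWalk_le [Finite V] [DecidableEq V] (h : IsCenteredBoundedFamily μ ξ 1)
    {k : ℕ} {w : Fin (k + 1) → V} (hw : NoSimpleEdge (Setoid.ker w)) :
    ∫ ω, ∏ i, ξ s(w i, w (i + 1)) ω ∂μ ≤ ∏ e ∈ walkEdges w, ∫ ω, ξ e ω ^ 2 ∂μ := by
  cases nonempty_fintype V
  rw [h.integral_prod_closedWalk, ← Fintype.prod_ite_mem (walkEdges w)]
  refine (le_abs_self _).trans ((Finset.abs_prod _ _).trans_le
    (Finset.prod_le_prod (fun _ _ => abs_nonneg _) fun e _ => ?_))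
  split_ifs with he
  · have two_le_edgeCount : 2 ≤ edgeCount w e :=
      (Nat.two_le_iff _).2 ⟨edgeCount_ne_zero_of_mem_walkEdges he, noSimpleEdge_ker_iff w |>.1 hw e⟩
    exact h.abs_integral_pow_le_integral_sq e two_le_edgeCount
  · exact h.abs_integral_pow_le_one e _

variable [Fintype V] [DecidableEq V]

theorem integrable_trace_pow_succ (h : IsCenteredBoundedFamily μ ξ K) (k : ℕ) :
    Integrable (fun ω => (symMatrix (ξ · ω) ^ (k + 1)).trace) μ := by
  simp only [trace_pow_succ_eq_sum_closedWalk, symMatrix, Matrix.of_apply]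
  exact integrable_finsetSum _ fun w _ => h.integrable_prod_comp _

theorem integral_trace_pow_succ (h : IsCenteredBoundedFamily μ ξ K) (k : ℕ) :
    ∫ ω, (symMatrix (ξ · ω) ^ (k + 1)).trace ∂μ =
      ∑ w : Fin (k + 1) → V, ∫ ω, ∏ i, ξ s(w i, w (i + 1)) ω ∂μ := by
  simp only [trace_pow_succ_eq_sum_closedWalk, symMatrix, Matrix.of_apply]
  exact integral_finsetSum _ fun w _ => h.integrable_prod_comp _

open scoped Classical in
theorem integral_trace_pow_succ_le (h : IsCenteredBoundedFamily μ ξ 1) (k : ℕ) :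
    ∫ ω, (symMatrix (ξ · ω) ^ (k + 1)).trace ∂μ ≤
      ∑ w : Fin (k + 1) → V with NoSimpleEdge (Setoid.ker w),
        ∏ e ∈ walkEdges w, ∫ ω, ξ e ω ^ 2 ∂μ := by
  rw [h.integral_trace_pow_succ, Finset.sum_filter]
  refine Finset.sum_le_sum fun w _ => ?_
  split_ifs with hw
  exacts [h.integral_prod_closedWalk_le hw, (h.integral_prod_closedWalk_eq_zero hw).le]

open scoped Classical in
theorem card_noSimpleEdge_le_integral_trace_pow_succ (h : IsCenteredBoundedFamily μ ξ K)
    (moment_ge : ∀ e c, 2 ≤ c → 1 ≤ ∫ ω, ξ e ω ^ c ∂μ) (k : ℕ) :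
    Finset.card {w : Fin (k + 1) → V | NoSimpleEdge (Setoid.ker w)} ≤
      ∫ ω, (symMatrix (ξ · ω) ^ (k + 1)).trace ∂μ := by
  rw [h.integral_trace_pow_succ, Finset.cast_card, Finset.sum_filter]
  refine Finset.sum_le_sum fun w _ => ?_
  split_ifs with hw
  · rw [h.integral_prod_closedWalk]
    refine Finset.one_le_prod fun e _ => ?_
    rcases eq_or_ne (edgeCount w e) 0 with untraversed | traversed
    · simp [untraversed]
    · exact moment_ge e _ ((Nat.two_le_iff _).2 ⟨traversed, (noSimpleEdge_ker_iff w).1 hw e⟩)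
  · exact (h.integral_prod_closedWalk_eq_zero hw).ge

theorem card_mul_integral_trace_pow_succ_le {W Ω' : Type*} [Fintype W] [DecidableEq W]
    [MeasurableSpace Ω'] {ν : Measure Ω'} [IsProbabilityMeasure ν] {η : Sym2 W → Ω' → ℝ}
    {D : ℝ} {k : ℕ} (hξ : IsCenteredBoundedFamily μ ξ 1) (hη : IsCenteredBoundedFamily ν η K)
    (variance_le : ∀ a, ∑ b, ∫ ω, ξ s(a, b) ω ^ 2 ∂μ ≤ D) (hD : 0 ≤ D)
    (moment_ge : ∀ e c, 2 ≤ c → 1 ≤ ∫ ω, η e ω ^ c ∂ν) (hW : D + k ≤ Fintype.card W) :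
    Fintype.card W * ∫ ω, (symMatrix (ξ · ω) ^ (k + 1)).trace ∂μ ≤
      Fintype.card V * ∫ ω, (symMatrix (η · ω) ^ (k + 1)).trace ∂ν := by
  classical
  refine (mul_le_mul_of_nonneg_left (hξ.integral_trace_pow_succ_le k) (Nat.cast_nonneg _)).trans
    (le_trans ?_ (mul_le_mul_of_nonneg_left
      (hη.card_noSimpleEdge_le_integral_trace_pow_succ moment_ge k) (Nat.cast_nonneg _)))
  exact card_mul_sum_le_of_patterns (fun e => integral_nonneg fun ω => sq_nonneg _) hD
    (fun e => (le_abs_self _).trans (hξ.abs_integral_pow_le_one e 2)) variance_le hW NoSimpleEdge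

end IsCenteredBoundedFamily

end TraceMoments

theorem three_le_two_pow_add_two_mul_neg_one_pow {c : ℕ} (hc : 2 ≤ c) :
    (3 : ℝ) ≤ 2 ^ c + 2 * (-1) ^ c := by
  rcases Nat.even_or_odd c with hpar | hpar
  · have : (2 : ℝ) ^ 2 ≤ 2 ^ c := pow_le_pow_right₀ one_le_two hc
    rw [hpar.neg_one_pow]
    linarith
  · have three_le : 3 ≤ c := Nat.lt_of_le_of_ne hc fun h => by
      exact Nat.not_odd_iff_even.2 even_two (h ▸ hpar)
    have : (2 : ℝ) ^ 3 ≤ 2 ^ c := pow_le_pow_right₀ one_le_two three_le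
    rw [hpar.neg_one_pow]
    linarith

-- A symmetric law would have vanishing odd moments. The law taking the value `2` with probability
-- `1 / 3` and `-1` otherwise is centred and has `c`-th moment `(2 ^ c + 2 * (-1) ^ c) / 3`.
theorem exists_isCenteredBoundedFamily_one_le_moments (ι : Type*) [Finite ι] :
    ∃ (μ : Measure (ι → Bool)) (η : ι → (ι → Bool) → ℝ), IsProbabilityMeasure μ ∧
      IsCenteredBoundedFamily μ η 2 ∧ ∀ e c, 2 ≤ c → 1 ≤ ∫ ω, η e ω ^ c ∂μ := by
  cases nonempty_fintype ι
  let coin : Measure Bool := bernoulliMeasure true false ⟨1 / 3, by norm_num, by norm_num⟩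
  let value (b : Bool) : ℝ := cond b 2 (-1)
  have moment (e : ι) (c : ℕ) :
      ∫ ω : ι → Bool, value (ω e) ^ c ∂Measure.pi (fun _ => coin) = (2 ^ c + 2 * (-1) ^ c) / 3 := by
    rw [integral_comp_eval (μ := fun _ => coin) (f := fun b => value b ^ c)
      (measurable_of_finite _).aestronglyMeasurable, integral_bernoulliMeasure]
    simp only [value, cond_true, cond_false, smul_eq_mul]
    ring
  refine ⟨Measure.pi fun _ => coin, fun e ω => value (ω e), inferInstance, ?_, fun e c hc => ?_⟩
  · refine ⟨fun e => (measurable_of_finite value).comp (measurable_pi_apply e),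
      iIndepFun_pi fun _ => (measurable_of_finite value).aemeasurable, fun e ω => ?_, fun e => ?_⟩
    · cases h : ω e <;> norm_num [value, h]
    · simpa using moment e 1
  · rw [moment, le_div_iff₀ zero_lt_three, one_mul]
    exact three_le_two_pow_add_two_mul_neg_one_pow hc

section SubgaussianNorm

theorem sum_sq_fiber_sum_le {V : Type*} [Fintype V] [DecidableEq V] (a : V × V → ℝ) :
    ∑ e : Sym2 V, (∑ ij : V × V with s(ij.1, ij.2) = e, a ij) ^ 2 ≤ 2 * ∑ ij, a ij ^ 2 := by
  calc ∑ e : Sym2 V, (∑ ij : V × V with s(ij.1, ij.2) = e, a ij) ^ 2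
      ≤ ∑ e : Sym2 V, 2 * ∑ ij : V × V with s(ij.1, ij.2) = e, a ij ^ 2 := by
        refine Finset.sum_le_sum fun e _ => sq_sum_le_card_mul_sum_sq.trans
          (mul_le_mul_of_nonneg_right ?_ (Finset.sum_nonneg fun _ _ => sq_nonneg _))
        induction e with | _ i j
        have fiber_subset : (Finset.univ.filter fun ij : V × V => s(ij.1, ij.2) = s(i, j)) ⊆
            {(i, j), (j, i)} := by
          intro ij hij
          have := Sym2.eq_iff.1 (Finset.mem_filter.1 hij).2
          simpa [Prod.ext_iff] using this
        exact_mod_cast (Finset.card_le_card fiber_subset).trans Finset.card_le_two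
    _ = 2 * ∑ ij, a ij ^ 2 := by rw [← Finset.mul_sum, Finset.sum_fiberwise]

theorem pow_le_mul_exp (q : ℕ) {t x : ℝ} (ht : 0 < t) (hx : 0 ≤ x) :
    x ^ q ≤ (q / t) ^ q * Real.exp (t * x) := by
  have factorial_le : (q.factorial : ℝ) ≤ q ^ q := by
    exact_mod_cast Nat.factorial_le_pow q
  calc x ^ q = (t * x) ^ q / t ^ q := by rw [mul_pow, mul_div_cancel_left₀ _ (by positivity)]
    _ ≤ q.factorial * Real.exp (t * x) / t ^ q := by
        gcongr
        exact (div_le_iff₀' (by positivity)).1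
          (Real.pow_div_factorial_le_exp (t * x) (by positivity) q)
    _ ≤ q ^ q * Real.exp (t * x) / t ^ q := by gcongr
    _ = (q / t) ^ q * Real.exp (t * x) := by rw [div_pow]; ring

variable {V : Type*} [Fintype V] [DecidableEq V]

theorem inner_toEuclideanCLM_symMatrix (x y : EuclideanSpace ℝ V) (z : Sym2 V → ℝ) :
    inner ℝ x (Matrix.toEuclideanCLM (𝕜 := ℝ) (symMatrix z) y) =
      ∑ e, (∑ ij : V × V with s(ij.1, ij.2) = e, x ij.1 * y ij.2) * z e := by
  calc inner ℝ x (Matrix.toEuclideanCLM (𝕜 := ℝ) (symMatrix z) y)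
      = ∑ ij : V × V, x ij.1 * y ij.2 * z s(ij.1, ij.2) := by
        simp [PiLp.inner_apply, Matrix.mulVec, dotProduct, symMatrix, Fintype.sum_prod_type,
          Finset.mul_sum, mul_comm, mul_left_comm]
    _ = ∑ e, (∑ ij : V × V with s(ij.1, ij.2) = e, x ij.1 * y ij.2) * z e := by
        rw [← Finset.sum_fiberwise Finset.univ fun ij : V × V => s(ij.1, ij.2)]
        refine Finset.sum_congr rfl fun e _ => ?_
        rw [Finset.sum_mul]
        refine Finset.sum_congr rfl fun ij hij => ?_
        rw [(Finset.mem_filter.1 hij).2]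

namespace IsCenteredBoundedFamily

variable {Ω : Type*} [MeasurableSpace Ω] {μ : Measure Ω} {ξ : Sym2 V → Ω → ℝ} {K : ℝ}

theorem measurable_norm_symMatrix (h : IsCenteredBoundedFamily μ ξ K) :
    Measurable fun ω => ‖symMatrix (ξ · ω)‖ := by
  have continuous_norm_symMatrix : Continuous fun z : Sym2 V → ℝ => ‖symMatrix z‖ :=
    continuous_norm.comp (continuous_matrix fun i j => continuous_apply s(i, j))
  exact continuous_norm_symMatrix.measurable.comp (measurable_pi_lambda _ h.measurable)

theorem norm_symMatrix_le (h : IsCenteredBoundedFamily μ ξ K) (ω : Ω) :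
    ‖symMatrix (ξ · ω)‖ ≤ Fintype.card V * |K| := by
  refine abs_le_of_sq_le_sq' ?_ (by positivity) |>.2
  calc ‖symMatrix (ξ · ω)‖ ^ 2 ≤ ∑ i : V, ∑ j : V, ξ s(i, j) ω ^ 2 := sq_l2_opNorm_le_sum_sq _
    _ ≤ ∑ _i : V, ∑ _j : V, K ^ 2 := Finset.sum_le_sum fun i _ => Finset.sum_le_sum fun j _ =>
        sq_le_sq.2 ((h.abs_apply_le _ ω).trans (le_abs_self K))
    _ = (Fintype.card V * |K|) ^ 2 := by
        simp only [Finset.sum_const, Finset.card_univ, nsmul_eq_mul, mul_pow, sq_abs]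
        ring

variable [IsProbabilityMeasure μ]

theorem hasSubgaussianMGF {ι : Type*} {ξ : ι → Ω → ℝ} (h : IsCenteredBoundedFamily μ ξ K)
    (e : ι) :
    HasSubgaussianMGF (ξ e) (‖K‖₊ ^ 2) μ := by
  have hoeffding := hasSubgaussianMGF_of_mem_Icc_of_integral_eq_zero (h.measurable e).aemeasurable
    (.of_forall fun ω => abs_le.1 (h.abs_apply_le e ω)) (h.integral_eq_zero e)
  rwa [sub_neg_eq_add, ← two_mul, nnnorm_mul, Real.nnnorm_two,
    mul_div_cancel_left₀ _ two_ne_zero] at hoeffding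

theorem hasSubgaussianMGF_sum_mul {ι : Type*} [Fintype ι] {ξ : ι → Ω → ℝ}
    (h : IsCenteredBoundedFamily μ ξ K) (a : ι → ℝ) :
    HasSubgaussianMGF (fun ω => ∑ e, a e * ξ e ω) (∑ e, ‖a e‖₊ ^ 2 * ‖K‖₊ ^ 2) μ := by
  refine HasSubgaussianMGF.sum_of_iIndepFun (c := fun e => ‖a e‖₊ ^ 2 * ‖K‖₊ ^ 2)
    (h.indep.comp (fun e x => a e * x) fun e => measurable_const_mul _) fun e _ => ?_
  have sq_nnnorm : ‖a e‖₊ ^ 2 = ⟨a e ^ 2, sq_nonneg _⟩ := NNReal.eq (sq_abs (a e))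
  rw [sq_nnnorm]
  exact (h.hasSubgaussianMGF e).const_mul (a e)

theorem hasSubgaussianMGF_inner (h : IsCenteredBoundedFamily μ ξ K) {x y : EuclideanSpace ℝ V}
    (hx : ‖x‖ ≤ 1) (hy : ‖y‖ ≤ 1) :
    HasSubgaussianMGF
      (fun ω => inner ℝ x (Matrix.toEuclideanCLM (𝕜 := ℝ) (symMatrix (ξ · ω)) y))
      (2 * ‖K‖₊ ^ 2) μ := by
  let a (e : Sym2 V) : ℝ := ∑ ij : V × V with s(ij.1, ij.2) = e, x ij.1 * y ij.2
  have sum_sq_le : ∑ e, a e ^ 2 ≤ 2 := by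
    calc ∑ e, a e ^ 2 ≤ 2 * ∑ ij : V × V, (x ij.1 * y ij.2) ^ 2 := sum_sq_fiber_sum_le _
      _ = 2 * (‖x‖ ^ 2 * ‖y‖ ^ 2) := by
        simp only [EuclideanSpace.real_norm_sq_eq, Finset.sum_mul_sum, mul_pow,
          Fintype.sum_prod_type]
      _ ≤ 2 := by
        have := mul_le_one₀ (pow_le_one₀ (n := 2) (norm_nonneg x) hx) (sq_nonneg ‖y‖)
          (pow_le_one₀ (norm_nonneg y) hy)
        linarith
  have variance_proxy_le : ∑ e, ‖a e‖₊ ^ 2 * ‖K‖₊ ^ 2 ≤ 2 * ‖K‖₊ ^ 2 := by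
    rw [← Finset.sum_mul, ← NNReal.coe_le_coe]
    push_cast
    simp only [Real.norm_eq_abs, sq_abs]
    gcongr
  simp only [inner_toEuclideanCLM_symMatrix]
  refine ⟨(h.hasSubgaussianMGF_sum_mul a).integrable_exp_mul, fun t =>
    ((h.hasSubgaussianMGF_sum_mul a).mgf_le t).trans (Real.exp_le_exp.2 ?_)⟩
  gcongr

theorem integrable_norm_symMatrix_pow (h : IsCenteredBoundedFamily μ ξ K) (q : ℕ) :
    Integrable (fun ω => ‖symMatrix (ξ · ω)‖ ^ q) μ := by
  refine .of_bound (h.measurable_norm_symMatrix.pow_const q).aestronglyMeasurable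
    ((Fintype.card V * |K|) ^ q) (.of_forall fun ω => ?_)
  rw [norm_pow, norm_norm]
  exact pow_le_pow_left₀ (norm_nonneg _) (h.norm_symMatrix_le ω) q

theorem integrable_norm_symMatrix (h : IsCenteredBoundedFamily μ ξ K) :
    Integrable (fun ω => ‖symMatrix (ξ · ω)‖) μ := by
  simpa only [pow_one] using h.integrable_norm_symMatrix_pow 1

theorem mgf_norm_symMatrix_le (h : IsCenteredBoundedFamily μ ξ K) {t : ℝ} (ht : 0 ≤ t) :
    mgf (fun ω => ‖symMatrix (ξ · ω)‖) μ t ≤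
      25 ^ Fintype.card V * Real.exp (16 * K ^ 2 * t ^ 2) := by
  obtain ⟨N, card_le, norm_le, exists_inner⟩ := exists_finset_l2_opNorm_le_four_mul_inner V
  let form (x y : EuclideanSpace ℝ V) (ω : Ω) : ℝ :=
    inner ℝ x (Matrix.toEuclideanCLM (𝕜 := ℝ) (symMatrix (ξ · ω)) y)
  have subgaussian {xy : _ × _} (hxy : xy ∈ N ×ˢ N) :
      HasSubgaussianMGF (form xy.1 xy.2) (2 * ‖K‖₊ ^ 2) μ :=
    have ⟨hx, hy⟩ := Finset.mem_product.1 hxy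
    h.hasSubgaussianMGF_inner (norm_le _ hx) (norm_le _ hy)
  have pointwise (ω : Ω) : Real.exp (t * ‖symMatrix (ξ · ω)‖) ≤
      ∑ xy ∈ N ×ˢ N, Real.exp (4 * t * form xy.1 xy.2 ω) := by
    obtain ⟨x, hx, y, hy, norm_le_form⟩ := exists_inner (symMatrix (ξ · ω))
    refine le_trans ?_ (Finset.single_le_sum
      (f := fun xy : _ × _ => Real.exp (4 * t * form xy.1 xy.2 ω)) (fun _ _ => (Real.exp_pos _).le)
      (Finset.mk_mem_product hx hy))
    rw [mul_comm 4 t, mul_assoc]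
    exact Real.exp_le_exp.2 (mul_le_mul_of_nonneg_left norm_le_form ht)
  have card_product_le : ((N ×ˢ N).card : ℝ) ≤ 25 ^ Fintype.card V := by
    rw [Finset.card_product, show (25 : ℝ) = 5 * 5 by norm_num, mul_pow]
    exact_mod_cast Nat.mul_le_mul card_le card_le
  calc mgf (fun ω => ‖symMatrix (ξ · ω)‖) μ t
      ≤ ∫ ω, ∑ xy ∈ N ×ˢ N, Real.exp (4 * t * form xy.1 xy.2 ω) ∂μ :=
        integral_mono_of_nonneg (.of_forall fun _ => (Real.exp_pos _).le)
          (integrable_finsetSum _ fun _ hxy => (subgaussian hxy).integrable_exp_mul _)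
          (.of_forall pointwise)
    _ = ∑ xy ∈ N ×ˢ N, mgf (form xy.1 xy.2) μ (4 * t) :=
        integral_finsetSum _ fun _ hxy => (subgaussian hxy).integrable_exp_mul _
    _ ≤ ∑ _xy ∈ N ×ˢ N, Real.exp ((2 * ‖K‖₊ ^ 2 : NNReal) * (4 * t) ^ 2 / 2) :=
        Finset.sum_le_sum fun _ hxy => (subgaussian hxy).mgf_le _
    _ = (N ×ˢ N).card * Real.exp (16 * K ^ 2 * t ^ 2) := by
        rw [Finset.sum_const, nsmul_eq_mul]
        push_cast
        rw [Real.norm_eq_abs, sq_abs]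
        ring_nf
    _ ≤ 25 ^ Fintype.card V * Real.exp (16 * K ^ 2 * t ^ 2) := by gcongr

theorem integral_norm_symMatrix_pow_le_pow_card_mul (h : IsCenteredBoundedFamily μ ξ K)
    (hK : 0 < K) {q : ℕ} (hq : q ≠ 0) : ∫ ω, ‖symMatrix (ξ · ω)‖ ^ q ∂μ ≤
      25 ^ Fintype.card V * (4 * Real.exp 1 * K * √q) ^ q := by
  -- The exponent that balances the two factors in `x ^ q ≤ (q / t) ^ q * exp (t * x)`.
  let t := √q / (4 * K)
  have ht : 0 < t := by positivity
  have pow_le (ω : Ω) : ‖symMatrix (ξ · ω)‖ ^ q ≤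
      (q / t) ^ q * Real.exp (t * ‖symMatrix (ξ · ω)‖) :=
    pow_le_mul_exp q ht (norm_nonneg _)
  have integrable_exp : Integrable (fun ω => Real.exp (t * ‖symMatrix (ξ · ω)‖)) μ :=
    integrable_exp_mul_of_mem_Icc h.measurable_norm_symMatrix.aemeasurable
      (.of_forall fun ω => ⟨norm_nonneg _, h.norm_symMatrix_le ω⟩)
  have sq_sqrt : √(q : ℝ) ^ 2 = q := Real.sq_sqrt q.cast_nonneg
  calc ∫ ω, ‖symMatrix (ξ · ω)‖ ^ q ∂μ
      ≤ ∫ ω, (q / t) ^ q * Real.exp (t * ‖symMatrix (ξ · ω)‖) ∂μ :=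
        integral_mono (h.integrable_norm_symMatrix_pow q) (integrable_exp.const_mul _) pow_le
    _ = (q / t) ^ q * mgf (fun ω => ‖symMatrix (ξ · ω)‖) μ t := integral_const_mul _ _
    _ ≤ (q / t) ^ q * (25 ^ Fintype.card V * Real.exp (16 * K ^ 2 * t ^ 2)) := by
        gcongr
        exact h.mgf_norm_symMatrix_le ht.le
    _ = (4 * K * √q) ^ q * (25 ^ Fintype.card V * Real.exp 1 ^ q) := by
        have quotient : q / t = 4 * K * √q := by
          simp only [t]
          field_simp
          rw [sq_sqrt]
        have exponent : 16 * K ^ 2 * t ^ 2 = q * 1 := by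
          simp only [t, div_pow, sq_sqrt]
          field_simp
          ring
        rw [quotient, exponent, Real.exp_nat_mul]
    _ = 25 ^ Fintype.card V * (4 * Real.exp 1 * K * √q) ^ q := by
        rw [mul_left_comm, ← mul_pow]
        ring_nf

end IsCenteredBoundedFamily

end SubgaussianNorm

section NormBound

theorem sqrt_add_le_add_sqrt {x y : ℝ} (hx : 0 ≤ x) (hy : 0 ≤ y) : √(x + y) ≤ √x + √y := by
  refine Real.sqrt_le_iff.2 ⟨by positivity, ?_⟩
  rw [add_sq, Real.sq_sqrt hx, Real.sq_sqrt hy]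
  linarith [mul_nonneg (Real.sqrt_nonneg x) (Real.sqrt_nonneg y)]

theorem exists_even_ge_sqrt_le {x : ℝ} (hx : 2⁻¹ < x) :
    ∃ q : ℕ, q ≠ 0 ∧ Even q ∧ x ≤ q ∧ √q ≤ 2 * √x := by
  have ceil_lt : (⌈x⌉₊ : ℝ) < 2 * x := Nat.ceil_lt_two_mul hx
  have ceil_ne_zero : ⌈x⌉₊ ≠ 0 := (Nat.ceil_pos.2 (by linarith)).ne'
  refine ⟨2 * ⌈x⌉₊, mul_ne_zero two_ne_zero ceil_ne_zero, even_two_mul _, ?_, ?_⟩ <;> push_cast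
  · linarith [Nat.le_ceil x]
  · refine Real.sqrt_le_iff.2 ⟨by positivity, ?_⟩
    rw [mul_pow, Real.sq_sqrt (by linarith)]
    linarith

namespace IsCenteredBoundedFamily

variable {V Ω : Type*} [Fintype V] [DecidableEq V] [MeasurableSpace Ω] {μ : Measure Ω}
  [IsProbabilityMeasure μ] {ξ : Sym2 V → Ω → ℝ} {K D : ℝ}

theorem integral_norm_symMatrix_pow_le_integral_trace_pow (h : IsCenteredBoundedFamily μ ξ K)
    {q : ℕ} (hq : q ≠ 0) (even : Even q) :
    ∫ ω, ‖symMatrix (ξ · ω)‖ ^ q ∂μ ≤ ∫ ω, (symMatrix (ξ · ω) ^ q).trace ∂μ := by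
  obtain ⟨k, rfl⟩ := Nat.exists_eq_succ_of_ne_zero hq
  refine integral_mono (h.integrable_norm_symMatrix_pow _) (h.integrable_trace_pow_succ k)
    fun ω => ?_
  obtain ⟨m, hm⟩ := even_iff_exists_two_mul.1 even
  simp only [hm]
  exact norm_pow_two_mul_le_trace_pow (symMatrix_isSymm _) (by omega)

theorem integral_trace_pow_le (h : IsCenteredBoundedFamily μ ξ K) {q : ℕ} (hq : q ≠ 0) :
    ∫ ω, (symMatrix (ξ · ω) ^ q).trace ∂μ ≤
      Fintype.card V * ∫ ω, ‖symMatrix (ξ · ω)‖ ^ q ∂μ := by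
  obtain ⟨k, rfl⟩ := Nat.exists_eq_succ_of_ne_zero hq
  rw [← integral_const_mul]
  refine integral_mono (h.integrable_trace_pow_succ k)
    ((h.integrable_norm_symMatrix_pow _).const_mul _) fun ω => ?_
  refine (trace_le_card_mul_l2_opNorm _).trans ?_
  gcongr
  exact norm_pow_le' _ k.succ_pos

theorem integral_norm_symMatrix_pow_le_card_mul (h : IsCenteredBoundedFamily μ ξ 1)
    (variance_le : ∀ a, ∑ b, ∫ ω, ξ s(a, b) ω ^ 2 ∂μ ≤ D) (hD : 0 ≤ D) {q : ℕ} (hq : q ≠ 0)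
    (even : Even q) (le_q : D ≤ q) :
    ∫ ω, ‖symMatrix (ξ · ω)‖ ^ q ∂μ ≤ Fintype.card V * (5000 * Real.exp 1 * √q) ^ q := by
  obtain ⟨ν, η, _, hη, moment_ge⟩ := exists_isCenteredBoundedFamily_one_le_moments
    (Sym2 (Fin (2 * q)))
  obtain ⟨k, hk⟩ := Nat.exists_eq_succ_of_ne_zero hq
  have dimension_ge : D + k ≤ Fintype.card (Fin (2 * q)) := by
    have : (q : ℝ) = k + 1 := by exact_mod_cast hk
    rw [Fintype.card_fin]
    push_cast
    linarith
  have comparison := h.card_mul_integral_trace_pow_succ_le hη variance_le hD moment_ge dimension_ge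
  rw [← Nat.succ_eq_add_one, ← hk, Fintype.card_fin] at comparison
  have dense_moment : ∫ ω, ‖symMatrix (η · ω)‖ ^ q ∂ν ≤ (5000 * Real.exp 1 * √q) ^ q := by
    refine (hη.integral_norm_symMatrix_pow_le_pow_card_mul two_pos hq).trans_eq ?_
    rw [Fintype.card_fin, pow_mul, ← mul_pow]
    ring_nf
  refine le_of_mul_le_mul_left (a := ((2 * q : ℕ) : ℝ)) ?_ (by positivity)
  calc ((2 * q : ℕ) : ℝ) * ∫ ω, ‖symMatrix (ξ · ω)‖ ^ q ∂μ
      ≤ (2 * q : ℕ) * ∫ ω, (symMatrix (ξ · ω) ^ q).trace ∂μ :=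
        mul_le_mul_of_nonneg_left
          (h.integral_norm_symMatrix_pow_le_integral_trace_pow hq even) (Nat.cast_nonneg _)
    _ ≤ Fintype.card V * ∫ ω, (symMatrix (η · ω) ^ q).trace ∂ν := comparison
    _ ≤ Fintype.card V * ((2 * q : ℕ) * (5000 * Real.exp 1 * √q) ^ q) := by
        gcongr
        refine (hη.integral_trace_pow_le hq).trans ?_
        rw [Fintype.card_fin]
        gcongr
    _ = (2 * q : ℕ) * (Fintype.card V * (5000 * Real.exp 1 * √q) ^ q) := mul_left_comm _ _ _

theorem pow_integral_norm_symMatrix_le (h : IsCenteredBoundedFamily μ ξ K) (q : ℕ) :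
    (∫ ω, ‖symMatrix (ξ · ω)‖ ∂μ) ^ q ≤ ∫ ω, ‖symMatrix (ξ · ω)‖ ^ q ∂μ :=
  (convexOn_pow q).map_integral_le (continuous_pow q).continuousOn isClosed_Ici
    (.of_forall fun _ => norm_nonneg _) h.integrable_norm_symMatrix
    (h.integrable_norm_symMatrix_pow q)

theorem integral_norm_symMatrix_le_of_log_card_le (h : IsCenteredBoundedFamily μ ξ 1)
    (variance_le : ∀ a, ∑ b, ∫ ω, ξ s(a, b) ω ^ 2 ∂μ ≤ D) (hD : 0 ≤ D) {q : ℕ} (hq : q ≠ 0)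
    (even : Even q) (le_q : D ≤ q) (log_card_le : Real.log (Fintype.card V) ≤ q) :
    ∫ ω, ‖symMatrix (ξ · ω)‖ ∂μ ≤ 5000 * Real.exp 2 * √q := by
  have card_le : (Fintype.card V : ℝ) ≤ Real.exp 1 ^ q := by
    rw [Real.exp_one_pow]
    exact (Real.le_exp_log _).trans (Real.exp_le_exp.2 log_card_le)
  refine le_of_pow_le_pow_left₀ hq (by positivity) ?_
  calc (∫ ω, ‖symMatrix (ξ · ω)‖ ∂μ) ^ q ≤ ∫ ω, ‖symMatrix (ξ · ω)‖ ^ q ∂μ :=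
        h.pow_integral_norm_symMatrix_le q
    _ ≤ Fintype.card V * (5000 * Real.exp 1 * √q) ^ q :=
        h.integral_norm_symMatrix_pow_le_card_mul variance_le hD hq even le_q
    _ ≤ Real.exp 1 ^ q * (5000 * Real.exp 1 * √q) ^ q := by gcongr
    _ = (5000 * Real.exp 2 * √q) ^ q := by
        rw [← mul_pow, show (2 : ℝ) = 1 + 1 by norm_num, Real.exp_add]
        ring_nf

theorem integral_norm_symMatrix_le_sqrt_card_mul (h : IsCenteredBoundedFamily μ ξ K)
    (variance_le : ∀ a, ∑ b, ∫ ω, ξ s(a, b) ω ^ 2 ∂μ ≤ D) :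
    ∫ ω, ‖symMatrix (ξ · ω)‖ ∂μ ≤ √(Fintype.card V * D) := by
  refine Real.le_sqrt_of_sq_le ((h.pow_integral_norm_symMatrix_le 2).trans ?_)
  have integrable_row (i : V) : Integrable (fun ω => ∑ j, ξ s(i, j) ω ^ 2) μ :=
    integrable_finsetSum _ fun j _ => h.integrable_pow _ 2
  calc ∫ ω, ‖symMatrix (ξ · ω)‖ ^ 2 ∂μ ≤ ∫ ω, ∑ i, ∑ j, ξ s(i, j) ω ^ 2 ∂μ :=
        integral_mono (h.integrable_norm_symMatrix_pow 2)
          (integrable_finsetSum _ fun i _ => integrable_row i) fun ω => sq_l2_opNorm_le_sum_sq _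
    _ = ∑ i, ∑ j, ∫ ω, ξ s(i, j) ω ^ 2 ∂μ := by
        rw [integral_finsetSum _ fun i _ => integrable_row i]
        exact Finset.sum_congr rfl fun i _ => integral_finsetSum _ fun j _ => h.integrable_pow _ 2
    _ ≤ ∑ _i : V, D := Finset.sum_le_sum fun i _ => variance_le i
    _ = Fintype.card V * D := by rw [Finset.sum_const, nsmul_eq_mul, Finset.card_univ]

theorem integral_norm_symMatrix_le (h : IsCenteredBoundedFamily μ ξ 1)
    (variance_le : ∀ a, ∑ b, ∫ ω, ξ s(a, b) ω ^ 2 ∂μ ≤ D) (hD : 0 ≤ D) :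
    ∫ ω, ‖symMatrix (ξ · ω)‖ ∂μ ≤
      10000 * Real.exp 2 * (√D + √(Real.log (Fintype.card V))) := by
  rcases le_or_gt (Fintype.card V) 1 with card_le_one | one_lt_card
  · have one_le : 1 ≤ 10000 * Real.exp 2 := by linarith [Real.one_le_exp zero_le_two]
    calc ∫ ω, ‖symMatrix (ξ · ω)‖ ∂μ ≤ √(Fintype.card V * D) :=
          h.integral_norm_symMatrix_le_sqrt_card_mul variance_le
      _ ≤ √D := Real.sqrt_le_sqrt (mul_le_of_le_one_left hD (by exact_mod_cast card_le_one))
      _ ≤ √D + √(Real.log (Fintype.card V)) := le_add_of_nonneg_right (Real.sqrt_nonneg _)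
      _ ≤ _ := le_mul_of_one_le_left (by positivity) one_le
  · set L := Real.log (Fintype.card V)
    have half_lt : 2⁻¹ < L := by
      have : Real.log 2 ≤ L := Real.log_le_log two_pos (by exact_mod_cast one_lt_card)
      linarith [Real.log_two_gt_d9]
    obtain ⟨q, hq, even, le_q, sqrt_le⟩ := exists_even_ge_sqrt_le (x := D + L) (by linarith)
    calc ∫ ω, ‖symMatrix (ξ · ω)‖ ∂μ ≤ 5000 * Real.exp 2 * √q :=
          h.integral_norm_symMatrix_le_of_log_card_le variance_le hD hq even (by linarith)
            (by linarith)
      _ ≤ 5000 * Real.exp 2 * (2 * (√D + √L)) := by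
        gcongr
        linarith [sqrt_add_le_add_sqrt hD (by linarith : 0 ≤ L)]
      _ = 10000 * Real.exp 2 * (√D + √L) := by ring

end IsCenteredBoundedFamily

end NormBound

namespace IsInhomogeneousRandomGraph

variable {n : ℕ} {Ω : Type*} [MeasurableSpace Ω] {μ : Measure Ω}
  {p : Matrix (Fin n) (Fin n) ℝ} {A : Ω → Matrix (Fin n) (Fin n) ℝ}

theorem prob_isSymm (h : IsInhomogeneousRandomGraph μ p A) : p.IsSymm := by
  refine Matrix.IsSymm.ext fun i j => ?_
  simp only [← h.prob, (h.symm _).apply]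

theorem prob_nonneg (h : IsInhomogeneousRandomGraph μ p A) (i j : Fin n) : 0 ≤ p i j :=
  h.prob i j ▸ measureReal_nonneg

theorem integral_entry (h : IsInhomogeneousRandomGraph μ p A) (i j : Fin n) :
    ∫ ω, A ω i j ∂μ = p i j := by
  have entry_eq_indicator : (fun ω => A ω i j) = Set.indicator {ω | A ω i j = 1} 1 := by
    ext ω
    rcases h.zero_or_one ω i j with entry | entry <;> simp [Set.indicator, entry]
  have measurableSet_eq_one : MeasurableSet {ω | A ω i j = 1} :=
    h.measurable i j (measurableSet_singleton 1)
  rw [entry_eq_indicator, integral_indicator_one measurableSet_eq_one, h.prob]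

theorem sum_prob_le_maxExpectedDegree (p : Matrix (Fin n) (Fin n) ℝ) (i : Fin n) :
    ∑ j, p i j ≤ maxExpectedDegree p :=
  le_ciSup (f := fun i => ∑ j, p i j) (Set.finite_range _).bddAbove i

theorem maxExpectedDegree_nonneg (h : IsInhomogeneousRandomGraph μ p A) :
    0 ≤ maxExpectedDegree p :=
  Real.iSup_nonneg fun i => Finset.sum_nonneg fun j _ => h.prob_nonneg i j

/-- The centred entry `A i j - p i j` with `i ≤ j`, as a function of the unordered pair `s(i, j)`:
the entries on and above the diagonal are the independent ones. -/
def centeredEdge (p : Matrix (Fin n) (Fin n) ℝ) (A : Ω → Matrix (Fin n) (Fin n) ℝ)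
    (e : Sym2 (Fin n)) (ω : Ω) : ℝ :=
  A ω (Sym2.sortEquiv e).1.1 (Sym2.sortEquiv e).1.2 -
    p (Sym2.sortEquiv e).1.1 (Sym2.sortEquiv e).1.2

theorem centeredEdge_mk (h : IsInhomogeneousRandomGraph μ p A) (i j : Fin n) (ω : Ω) :
    centeredEdge p A s(i, j) ω = A ω i j - p i j := by
  rcases le_total i j with hij | hij
  · simp [centeredEdge, Sym2.sortEquiv, hij]
  · simp [centeredEdge, Sym2.sortEquiv, hij, (h.symm ω).apply, h.prob_isSymm.apply]

theorem sub_expectedMatrix_eq (h : IsInhomogeneousRandomGraph μ p A) (ω : Ω) :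
    A ω - expectedMatrix μ A = symMatrix (centeredEdge p A · ω) := by
  ext i j
  simp only [symMatrix, expectedMatrix, Matrix.sub_apply, Matrix.of_apply, h.centeredEdge_mk,
    h.integral_entry]

variable [IsProbabilityMeasure μ]

theorem prob_le_one (h : IsInhomogeneousRandomGraph μ p A) (i j : Fin n) : p i j ≤ 1 :=
  h.prob i j ▸ measureReal_le_one

theorem integrable_entry (h : IsInhomogeneousRandomGraph μ p A) (i j : Fin n) :
    Integrable (fun ω => A ω i j) μ := by
  refine .of_bound (h.measurable i j).aestronglyMeasurable 1 (.of_forall fun ω => ?_)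
  rcases h.zero_or_one ω i j with entry | entry <;> simp [entry]

theorem abs_entry_sub_prob_le_one (h : IsInhomogeneousRandomGraph μ p A) (ω : Ω) (i j : Fin n) :
    |A ω i j - p i j| ≤ 1 := by
  have := h.prob_nonneg i j
  have := h.prob_le_one i j
  rw [abs_le]
  rcases h.zero_or_one ω i j with entry | entry <;> rw [entry] <;> constructor <;> linarith

theorem integral_sq_entry_sub_prob_le (h : IsInhomogeneousRandomGraph μ p A) (i j : Fin n) :
    ∫ ω, (A ω i j - p i j) ^ 2 ∂μ ≤ p i j := by
  have sq_eq (ω : Ω) : (A ω i j - p i j) ^ 2 = (1 - 2 * p i j) * A ω i j + p i j ^ 2 := by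
    rcases h.zero_or_one ω i j with entry | entry <;> rw [entry] <;> ring
  simp only [sq_eq]
  rw [integral_add ((h.integrable_entry i j).const_mul _) (integrable_const _),
    integral_const_mul, h.integral_entry, integral_const, probReal_univ, one_smul]
  linarith [sq_nonneg (p i j)]

theorem isCenteredBoundedFamily_centeredEdge (h : IsInhomogeneousRandomGraph μ p A) :
    IsCenteredBoundedFamily μ (centeredEdge p A) 1 where
  measurable e := (h.measurable _ _).sub_const _
  abs_apply_le e ω := h.abs_entry_sub_prob_le_one ω _ _
  indep := (h.indep.precomp Sym2.sortEquiv.injective).comp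
    (fun e x => x - p (Sym2.sortEquiv e).1.1 (Sym2.sortEquiv e).1.2)
    fun e => measurable_id.sub_const _
  integral_eq_zero e := by
    simp only [centeredEdge]
    rw [integral_sub (h.integrable_entry _ _) (integrable_const _), h.integral_entry,
      integral_const, probReal_univ, one_smul, sub_self]

theorem sum_integral_sq_centeredEdge_le (h : IsInhomogeneousRandomGraph μ p A) (i : Fin n) :
    ∑ j, ∫ ω, centeredEdge p A s(i, j) ω ^ 2 ∂μ ≤ maxExpectedDegree p := by
  simp only [h.centeredEdge_mk]
  exact (Finset.sum_le_sum fun j _ => h.integral_sq_entry_sub_prob_le i j).trans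
    (sum_prob_le_maxExpectedDegree p i)

theorem integrable_norm_sub_expectedMatrix (h : IsInhomogeneousRandomGraph μ p A) :
    Integrable (fun ω => ‖A ω - expectedMatrix μ A‖) μ := by
  simpa only [h.sub_expectedMatrix_eq] using
    h.isCenteredBoundedFamily_centeredEdge.integrable_norm_symMatrix

theorem integral_norm_sub_expectedMatrix_le (h : IsInhomogeneousRandomGraph μ p A) :
    ∫ ω, ‖A ω - expectedMatrix μ A‖ ∂μ ≤
      10000 * Real.exp 2 * (√(maxExpectedDegree p) + √(Real.log n)) := by
  simpa only [h.sub_expectedMatrix_eq, Fintype.card_fin] using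
    h.isCenteredBoundedFamily_centeredEdge.integral_norm_symMatrix_le
      h.sum_integral_sq_centeredEdge_le h.maxExpectedDegree_nonneg

end IsInhomogeneousRandomGraph

-- `‖·‖` on matrices is the operator norm with respect to the Euclidean norm.
theorem mainTheorem5 :
    (∃ C : ℝ, 0 < C ∧
      ∀ (n : ℕ) (Ω : Type u) [MeasurableSpace Ω] (μ : Measure Ω) [IsProbabilityMeasure μ]
        (p : Matrix (Fin n) (Fin n) ℝ) (A : Ω → Matrix (Fin n) (Fin n) ℝ),
        IsInhomogeneousRandomGraph μ p A →
          Integrable (fun ω => ‖A ω - expectedMatrix μ A‖) μ ∧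
          ∫ ω, ‖A ω - expectedMatrix μ A‖ ∂μ ≤
            C * (√(maxExpectedDegree p) + √(Real.log n))) ∧
    (∀ c : ℝ, 0 < c → ∃ C : ℝ, 0 < C ∧
      ∀ (n : ℕ) (Ω : Type u) [MeasurableSpace Ω] (μ : Measure Ω) [IsProbabilityMeasure μ]
        (p : Matrix (Fin n) (Fin n) ℝ) (A : Ω → Matrix (Fin n) (Fin n) ℝ),
        IsInhomogeneousRandomGraph μ p A → c * Real.log n ≤ maxExpectedDegree p →
          ∫ ω, ‖A ω - expectedMatrix μ A‖ ∂μ ≤ C * √(maxExpectedDegree p)) := by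
  refine ⟨⟨10000 * Real.exp 2, by positivity, fun n Ω _ μ _ p A h =>
      ⟨h.integrable_norm_sub_expectedMatrix, h.integral_norm_sub_expectedMatrix_le⟩⟩,
    fun c hc => ⟨10000 * Real.exp 2 * (1 + √(1 / c)), by positivity, fun n Ω _ μ _ p A h hd => ?_⟩⟩
  have sqrt_log_le : √(Real.log n) ≤ √(1 / c) * √(maxExpectedDegree p) := by
    rw [← Real.sqrt_mul (by positivity), one_div, inv_mul_eq_div]
    exact Real.sqrt_le_sqrt ((le_div_iff₀' hc).2 hd)
  calc ∫ ω, ‖A ω - expectedMatrix μ A‖ ∂μ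
      ≤ 10000 * Real.exp 2 * (√(maxExpectedDegree p) + √(Real.log n)) :=
        h.integral_norm_sub_expectedMatrix_le
    _ ≤ 10000 * Real.exp 2 *
          (√(maxExpectedDegree p) + √(1 / c) * √(maxExpectedDegree p)) := by gcongr
    _ = 10000 * Real.exp 2 * (1 + √(1 / c)) * √(maxExpectedDegree p) := by ring
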